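/- **Setting.** An instance consists of $n\ge 1$ jobs $J_1,\dots,J_n$ for a single machine; job $J_i$ has a release time $r_i\in\mathbb N$ and a processing time $p_i\in\mathbb N$, $p_i\ge 1$, and is viewed as a chain of $p_i$ unit tasks. Time is divided into unit slots $[t,t+1]$, $t\in\mathbb N$. A (preemptive) schedule $\mathcal S$ assigns to every slot at most one job, one task of which is executed in that slot; it is feasible if in each slot $[t,t+1]$ it only executes a job that is active at time $t$ (released by time $t$ and not completed by time $t$), and if it completes every job. Let $c_i(\mathcal S)$ be the completion time of $J_i$, $f_i(\mathcal S)=c_i(\mathcal S)-r_i$ its flow time, and let the objective be the $\ell_2$ norm of flow time $\|f(\mathcal S)\|_2=\bigl(\sum_{i=1}^n f_i(\mathcal S)^2\bigr)^{1/2}$. A (clairvoyant) online algorithm chooses what to execute in slot $[t,t+1]$ knowing only the jobs released by time $t$, with their release times and sizes. It is $c$-competitive on instances with $n$ jobs if, on each of them, its schedule is feasible and its objective value is at most $c$ times that of every feasible schedule (equivalently, of an optimal one). SRPT is the algorithm that, whenever some job is active, executes an active job with the fewest remaining tasks (ties are broken by an arbitrary online rule). **The algorithm $BAL(\theta)$.**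 Let $q_t(i)$ be the number of remaining tasks of $J_i$ at time $t$ under $BAL(\theta)$. An active job $J_i$ becomes starving at the first time $t_i$ at which it is active and $\frac{t_i-r_i}{q_{t_i}(i)}\ge\theta$, and it remains starving until it is completed; put $\gamma_i=\frac{t_i-r_i}{q_{t_i}(i)}$. If there are starving jobs at time $t$ (including those that become starving at time $t$), $BAL(\theta)$ executes in slot $[t,t+1]$ the starving job with the smallest $t_i$, ties being broken by the largest $\gamma_i$ and then by the smallest index. Otherwise, among the tasks that SRPT, run on the same instance, executes in the slots $[0,1],\dots,[t,t+1]$ and that $BAL(\theta)$ has not executed before time $t$, it executes the one that SRPT completes first; if there is no such task, the slot is idle. **Theorem.** There is an absolute constant $C>0$ such that for all $n\ge 1$ and all reals $\alpha,\beta,\tilde n$ with $\frac1n\le\beta\le 1\le\alpha$ and $\beta n\le\tilde n\le\alpha n$, the online algorithm $BAL(\tilde n^{2/3})$ is $$C\,n^{1/3}\left(\beta^{-1/6}+\alpha^{1/3}\right)\text{-competitive}$$ for minimizing the $\ell_2$ norm of flow time on instances with $n$ jobs. -/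

import Mathlib

namespace FlowTime

/-- An instance with `n` jobs: job `i` is released at the integer time `release i` and has the
positive integer processing time `size i` (it is a chain of `size i` unit tasks). -/
structure Instance (n : ℕ) where
  release : Fin n → ℕ
  size : Fin n → ℕ
  size_pos : ∀ i, 0 < size i

/-- A (preemptive, single machine) schedule: the job, if any, one task of which is executed in
time slot `[t, t+1]`. The tasks of a job are executed in the order of its chain, so the `k`-th slot
given to job `i` executes its `k`-th task. -/
abbrev Schedule (n : ℕ) := ℕ → Option (Fin n)

variable {n : ℕ}

/-- The number of tasks of job `i` that `σ` has executed by time `t`. -/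
def work (σ : Schedule n) (t : ℕ) (i : Fin n) : ℕ :=
  ((Finset.range t).filter (fun s => σ s = some i)).card

/-- The number of remaining tasks of job `i` at time `t`. -/
def remaining (I : Instance n) (σ : Schedule n) (t : ℕ) (i : Fin n) : ℕ :=
  I.size i - work σ t i

/-- Job `i` is active at time `t`: released by time `t` and not yet completed by time `t`. -/
def Active (I : Instance n) (σ : Schedule n) (t : ℕ) (i : Fin n) : Prop :=
  I.release i ≤ t ∧ 0 < remaining I σ t i

/-- `σ` only ever executes active jobs, and it completes every job. -/
def IsFeasible (I : Instance n) (σ : Schedule n) : Prop :=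
  (∀ t i, σ t = some i → Active I σ t i) ∧ ∀ i, ∃ t, remaining I σ t i = 0

/-- The completion time of job `i`: the first time at which no task of the job remains.
(Only used for feasible schedules, where there is such a time.) -/
noncomputable def completionTime (I : Instance n) (σ : Schedule n) (i : Fin n) : ℕ :=
  sInf {t | remaining I σ t i = 0}

/-- The flow time of job `i`. -/
noncomputable def flowTime (I : Instance n) (σ : Schedule n) (i : Fin n) : ℝ :=
  (completionTime I σ i : ℝ) - (I.release i : ℝ)

/-- The `ℓ₂` norm of flow time. -/
noncomputable def l2FlowTime (I : Instance n) (σ : Schedule n) : ℝ :=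
  Real.sqrt (∑ i, flowTime I σ i ^ 2)

/-- `I` and `J` look the same at time `t`: they have the same jobs released by time `t`, with the
same release times and (clairvoyance) the same sizes. -/
def SameUpTo (t : ℕ) (I J : Instance n) : Prop :=
  ∀ i, (I.release i ≤ t ∨ J.release i ≤ t) → I.release i = J.release i ∧ I.size i = J.size i

/-- A clairvoyant online scheduling algorithm: the decision for time slot `[t, t+1]` depends only
on the jobs that are released by time `t`. -/
structure OnlineAlgorithm (n : ℕ) where
  schedule : Instance n → Schedule n
  online : ∀ (I J : Instance n) (t : ℕ), SameUpTo t I J → schedule I t = schedule J t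

/-- `A` is `c`-competitive for minimizing the `ℓ₂` norm of flow time, on instances with `n` jobs:
it completes all jobs, and its objective value is at most `c` times that of every feasible
schedule, hence at most `c` times the optimal one. -/
def OnlineAlgorithm.IsCompetitive (A : OnlineAlgorithm n) (c : ℝ) : Prop :=
  ∀ I : Instance n, IsFeasible I (A.schedule I) ∧
    ∀ σ : Schedule n, IsFeasible I σ → l2FlowTime I (A.schedule I) ≤ c * l2FlowTime I σ

/-- `σ` is a schedule of Shortest Remaining Processing Time on `I`, with ties broken in some way:
whenever there are active jobs, it executes one with the fewest remaining tasks. -/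
def IsSRPTSchedule (I : Instance n) (σ : Schedule n) : Prop :=
  ∀ t,
    (∀ i, σ t = some i →
      Active I σ t i ∧ ∀ j, Active I σ t j → remaining I σ t i ≤ remaining I σ t j) ∧
    (σ t = none → ∀ j, ¬ Active I σ t j)

/-- The online algorithm `A` is SRPT (with some rule for breaking ties). -/
def OnlineAlgorithm.IsSRPT (A : OnlineAlgorithm n) : Prop :=
  ∀ I : Instance n, IsSRPTSchedule I (A.schedule I)

section BAL

/-- The ratio `(t - rᵢ) / qₜ(i)` under the schedule `σ`. -/
noncomputable def waitRatio (I : Instance n) (σ : Schedule n) (t : ℕ) (i : Fin n) : ℝ :=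
  ((t : ℝ) - (I.release i : ℝ)) / (remaining I σ t i : ℝ)

/-- Job `i` is active at time `t` and meets the starvation threshold `θ`. -/
def MeetsThreshold (I : Instance n) (θ : ℝ) (σ : Schedule n) (t : ℕ) (i : Fin n) : Prop :=
  Active I σ t i ∧ θ ≤ waitRatio I σ t i

/-- The time `tᵢ` at which job `i` becomes starving (if it ever does). -/
noncomputable def starvingTime (I : Instance n) (θ : ℝ) (σ : Schedule n) (i : Fin n) : ℕ :=
  sInf {t | MeetsThreshold I θ σ t i}

open Classical in
/-- The set `ST` at time `t`: the jobs that have become starving by time `t` and are not yet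
completed. -/
noncomputable def starvingSet (I : Instance n) (θ : ℝ) (σ : Schedule n) (t : ℕ) : Finset (Fin n) :=
  Finset.univ.filter (fun i => Active I σ t i ∧ ∃ s ≤ t, MeetsThreshold I θ σ s i)

/-- The priority of a starving job, smaller keys first: smallest `tᵢ`, then largest
`γᵢ = (tᵢ - rᵢ) / q_{tᵢ}(i)`, then smallest index. -/
noncomputable def starvingKey (I : Instance n) (θ : ℝ) (σ : Schedule n) (i : Fin n) :
    ℕ ×ₗ (ℝ ×ₗ Fin n) :=
  toLex (starvingTime I θ σ i, toLex (-waitRatio I σ (starvingTime I θ σ i) i, i))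

/-- The task that the SRPT schedule `ρ` executes in slot `s` (if any) is not among the tasks that
`σ` has executed before time `t`. If `ρ s = some i`, that task is the task of job `i` with number
`work ρ (s + 1) i`. -/
def Pending (ρ σ : Schedule n) (t s : ℕ) : Prop :=
  ∃ i, ρ s = some i ∧ work σ t i < work ρ (s + 1) i

open Classical in
/-- The decision of `BAL(θ)` for time slot `[t, t+1]`. Here `ρ` is the SRPT schedule, and `σ` is
what `BAL(θ)` has executed before time `t`. If jobs are starving, the first of them in the priority
order is executed. Otherwise, among the tasks that SRPT executes in the slots `0, …, t` and that
`BAL(θ)` has not executed yet, the one completed first under SRPT is executed. -/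
noncomputable def balStep (I : Instance n) (θ : ℝ) (ρ σ : Schedule n) (t : ℕ) : Option (Fin n) :=
  if hST : (starvingSet I θ σ t).Nonempty then
    some (Finset.exists_min_image (starvingSet I θ σ t) (starvingKey I θ σ) hST).choose
  else if hP : ∃ s, s ≤ t ∧ Pending ρ σ t s then
    ρ (Nat.find hP)
  else
    none

/-- What `BAL(θ)` executes in the slots before time `t` (followed by idle slots). -/
noncomputable def balHistory (I : Instance n) (θ : ℝ) (ρ : Schedule n) : ℕ → Schedule n
  | 0 => fun _ => none
  | t + 1 => Function.update (balHistory I θ ρ t) t (balStep I θ ρ (balHistory I θ ρ t) t)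

/-- The schedule of `BAL(θ)` on `I`, where `ρ` is the SRPT schedule on `I`. -/
noncomputable def balSchedule (I : Instance n) (θ : ℝ) (ρ : Schedule n) : Schedule n :=
  fun t => balStep I θ ρ (balHistory I θ ρ t) t

theorem SameUpTo.mono {s t : ℕ} {I J : Instance n} (h : SameUpTo t I J) (hst : s ≤ t) :
    SameUpTo s I J :=
  fun i hi => h i (hi.imp (fun a => a.trans hst) (fun a => a.trans hst))

theorem work_congr {ρ ρ' : Schedule n} {t : ℕ} (h : ∀ s < t, ρ s = ρ' s) (i : Fin n) :
    work ρ t i = work ρ' t i := by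
  unfold work
  congr 1
  apply Finset.filter_congr
  intro s hs
  rw [h s (Finset.mem_range.mp hs)]

theorem active_congr {I J : Instance n} {σ : Schedule n} {t : ℕ} {i : Fin n}
    (hr : I.release i = J.release i) (hp : I.size i = J.size i) :
    Active I σ t i ↔ Active J σ t i := by
  unfold Active remaining
  rw [hr, hp]

theorem waitRatio_congr {I J : Instance n} {σ : Schedule n} {t : ℕ} {i : Fin n}
    (hr : I.release i = J.release i) (hp : I.size i = J.size i) :
    waitRatio I σ t i = waitRatio J σ t i := by
  unfold waitRatio remaining
  rw [hr, hp]

theorem meetsThreshold_congr {I J : Instance n} {θ : ℝ} {σ : Schedule n} {t : ℕ} {i : Fin n}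
    (hr : I.release i = J.release i) (hp : I.size i = J.size i) :
    MeetsThreshold I θ σ t i ↔ MeetsThreshold J θ σ t i := by
  unfold MeetsThreshold
  rw [active_congr hr hp, waitRatio_congr hr hp]

theorem starvingKey_congr {I J : Instance n} {θ : ℝ} {σ : Schedule n} {i : Fin n}
    (hr : I.release i = J.release i) (hp : I.size i = J.size i) :
    starvingKey I θ σ i = starvingKey J θ σ i := by
  have h : starvingTime I θ σ i = starvingTime J θ σ i := by
    unfold starvingTime
    simp only [meetsThreshold_congr hr hp]
  unfold starvingKey
  rw [h, waitRatio_congr hr hp]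

theorem starvingKey_injective (I : Instance n) (θ : ℝ) (σ : Schedule n) :
    Function.Injective (starvingKey I θ σ) := by
  intro i j h
  have h1 := congrArg (fun x => (ofLex (ofLex x).2).2) h
  simpa [starvingKey] using h1

theorem starvingSet_congr {I J : Instance n} {θ : ℝ} {σ : Schedule n} {t : ℕ}
    (h : SameUpTo t I J) : starvingSet I θ σ t = starvingSet J θ σ t := by
  ext i
  simp only [starvingSet, Finset.mem_filter, Finset.mem_univ, true_and]
  constructor
  · rintro ⟨ha, s, hs, hm⟩
    obtain ⟨hr, hp⟩ := h i (Or.inl ha.1)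
    exact ⟨(active_congr hr hp).1 ha, s, hs, (meetsThreshold_congr hr hp).1 hm⟩
  · rintro ⟨ha, s, hs, hm⟩
    obtain ⟨hr, hp⟩ := h i (Or.inr ha.1)
    exact ⟨(active_congr hr hp).2 ha, s, hs, (meetsThreshold_congr hr hp).2 hm⟩

theorem pending_congr {ρ ρ' σ : Schedule n} {t s : ℕ} (h : ∀ u ≤ t, ρ u = ρ' u) (hs : s ≤ t) :
    Pending ρ σ t s ↔ Pending ρ' σ t s := by
  unfold Pending
  have hw : ∀ i, work ρ (s + 1) i = work ρ' (s + 1) i :=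
    fun i => work_congr (fun u hu => h u (by omega)) i
  simp only [hw, h s hs]

theorem balStep_congr {I J : Instance n} {θ : ℝ} {ρ ρ' σ : Schedule n} {t : ℕ}
    (h : SameUpTo t I J) (hρ : ∀ u ≤ t, ρ u = ρ' u) :
    balStep I θ ρ σ t = balStep J θ ρ' σ t := by
  classical
  have hset : starvingSet I θ σ t = starvingSet J θ σ t := starvingSet_congr h
  have hpend : ∀ s, (s ≤ t ∧ Pending ρ σ t s) ↔ (s ≤ t ∧ Pending ρ' σ t s) :=
    fun s => and_congr_right (fun hs => pending_congr hρ hs)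
  by_cases hST : (starvingSet I θ σ t).Nonempty
  · have hST' : (starvingSet J θ σ t).Nonempty := hset ▸ hST
    rw [balStep, balStep, dif_pos hST, dif_pos hST']
    congr 1
    obtain ⟨hx, hxmin⟩ :=
      (Finset.exists_min_image (starvingSet I θ σ t) (starvingKey I θ σ) hST).choose_spec
    obtain ⟨hy, hymin⟩ :=
      (Finset.exists_min_image (starvingSet J θ σ t) (starvingKey J θ σ) hST').choose_spec
    generalize (Finset.exists_min_image (starvingSet I θ σ t) (starvingKey I θ σ) hST).choose = x
      at *
    generalize (Finset.exists_min_image (starvingSet J θ σ t) (starvingKey J θ σ) hST').choose = y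
      at *
    have hkey : ∀ i ∈ starvingSet I θ σ t, starvingKey I θ σ i = starvingKey J θ σ i := by
      intro i hi
      have ha : Active I σ t i := by
        simp only [starvingSet, Finset.mem_filter] at hi
        exact hi.2.1
      obtain ⟨hr, hp⟩ := h i (Or.inl ha.1)
      exact starvingKey_congr hr hp
    have h1 : starvingKey I θ σ x ≤ starvingKey I θ σ y := hxmin y (hset ▸ hy)
    have h2 : starvingKey J θ σ y ≤ starvingKey J θ σ x := hymin x (hset ▸ hx)
    rw [← hkey x hx, ← hkey y (hset ▸ hy)] at h2
    exact starvingKey_injective I θ σ (le_antisymm h1 h2)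
  · have hST' : ¬ (starvingSet J θ σ t).Nonempty := hset ▸ hST
    rw [balStep, balStep, dif_neg hST, dif_neg hST']
    by_cases hP : ∃ s, s ≤ t ∧ Pending ρ σ t s
    · have hP' : ∃ s, s ≤ t ∧ Pending ρ' σ t s := by
        obtain ⟨s, hs⟩ := hP
        exact ⟨s, (hpend s).1 hs⟩
      rw [dif_pos hP, dif_pos hP', hρ _ (Nat.find_spec hP).1]
      congr 1
      exact Nat.find_congr' (fun {s} => hpend s)
    · have hP' : ¬ ∃ s, s ≤ t ∧ Pending ρ' σ t s := by
        rintro ⟨s, hs⟩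
        exact hP ⟨s, (hpend s).2 hs⟩
      rw [dif_neg hP, dif_neg hP']

theorem balHistory_congr {I J : Instance n} {θ : ℝ} {ρ ρ' : Schedule n} {t : ℕ}
    (h : SameUpTo t I J) (hρ : ∀ u ≤ t, ρ u = ρ' u) :
    ∀ s ≤ t, balHistory I θ ρ s = balHistory J θ ρ' s := by
  intro s
  induction s with
  | zero => intro _; rfl
  | succ s ih =>
    intro hs
    have hs' : s ≤ t := by omega
    simp only [balHistory]
    rw [ih hs', balStep_congr (h.mono hs') (fun u hu => hρ u (hu.trans hs'))]

/-- The online algorithm `BAL(θ)`, which follows the SRPT algorithm `srpt` on normal jobs. -/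
noncomputable def BAL (srpt : OnlineAlgorithm n) (θ : ℝ) : OnlineAlgorithm n where
  schedule I := balSchedule I θ (srpt.schedule I)
  online I J t h := by
    have hρ : ∀ u ≤ t, srpt.schedule I u = srpt.schedule J u :=
      fun u hu => srpt.online I J u (h.mono hu)
    unfold balSchedule
    rw [balHistory_congr h hρ t le_rfl, balStep_congr h hρ]

end BAL

end FlowTime

namespace FlowTime

variable {n : ℕ}

/-! Fix a feasible `σ` and let `O` be the sum of its squared flow times. The core is
`sum_natFlow_sq_le`: for `θ ≥ 1` the squared flow times of BAL(θ) sum to at most `10 (θ + n/√θ) O`.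
The choice `θ = ñ^(2/3)` balances the two terms at order `n^(2/3)`, up to powers of `α` and `β`.

Three quantities are charged to `O`. First, SRPT minimizes total flow time, and flow times are
integers, so the SRPT flow times sum to at most `O`. Second, at no time has BAL(θ) done less total
work than SRPT, nor SRPT less than `σ`; summing the unfinished volume over time gives `∑ qᵢ wᵢ ≤ O`,
where `qᵢ` and `wᵢ` are the remaining tasks and the wait of job `i` when it becomes starving
(`IsBALSchedule.sum_mul_starvingWait_le`). Third, by the exchange lemma
`IsSRPTSchedule.exists_removal`, tasks `x` that SRPT has left at time `a` are expensive for every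
schedule unless `∑ xᵢ²` is large compared with `(∑ xᵢ)²` (`IsSRPTSchedule.mul_sum_sq_le`).

Consider a phase `[a, c)` in which BAL(θ) serves only starving jobs released by `a` and tasks that
SRPT has done by `a`. It ends with BAL(θ) ahead of SRPT's state at `a` by at least `c - a` tasks, at
most `qₖ` of them in each starving job `k` and none elsewhere. As `wₖ ≥ θ qₖ`, the second bound
gives `θ ∑ qₖ² ≤ O`, and the tradeoff yields `(c - a)² ≤ 2O/√θ` (`IsBALSchedule.sqrt_mul_sq_le`).

A job that never starves has flow time at most `2θ` and finishes at most one phase after its SRPT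
completion. A starving job waits `wᵢ ≤ 3θ qᵢ` and then finishes within one phase. Summing over the
jobs gives the bound. -/

/-- The schedule only executes active jobs. -/
def OnlyActive (I : Instance n) (σ : Schedule n) : Prop :=
  ∀ t i, σ t = some i → Active I σ t i

/-! ### Counting executed and remaining tasks. -/

theorem work_zero (σ : Schedule n) (i : Fin n) : work σ 0 i = 0 := by
  simp [work]

theorem work_succ (σ : Schedule n) (t : ℕ) (i : Fin n) :
    work σ (t + 1) i = work σ t i + if σ t = some i then 1 else 0 := by
  unfold work
  rw [Finset.range_add_one, Finset.filter_insert]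
  split_ifs with h <;> simp

theorem work_succ_of_eq {σ : Schedule n} {t : ℕ} {i : Fin n} (h : σ t = some i) :
    work σ (t + 1) i = work σ t i + 1 := by
  rw [work_succ, if_pos h]

theorem work_succ_of_ne {σ : Schedule n} {t : ℕ} {i : Fin n} (h : σ t ≠ some i) :
    work σ (t + 1) i = work σ t i := by
  rw [work_succ, if_neg h, add_zero]

theorem work_mono (σ : Schedule n) (i : Fin n) : Monotone fun t => work σ t i :=
  monotone_nat_of_le_succ fun t => by simp only [work_succ]; omega

theorem sum_work_succ (σ : Schedule n) (t : ℕ) :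
    ∑ i, work σ (t + 1) i = ∑ i, work σ t i + if σ t = none then 0 else 1 := by
  simp only [work_succ, Finset.sum_add_distrib]
  congr 1
  cases h : σ t with
  | none => simp
  | some k => simp

theorem sum_work_add_of_busy {σ : Schedule n} {a c : ℕ} (hac : a ≤ c)
    (h : ∀ t, a ≤ t → t < c → σ t ≠ none) :
    ∑ i, work σ c i = ∑ i, work σ a i + (c - a) := by
  induction c, hac using Nat.le_induction with
  | base => simp
  | succ c hc ih =>
    rw [sum_work_succ, if_neg (h c hc (by omega)), ih fun t h1 h2 => h t h1 (by omega)]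
    omega

/-- The count only grows in slots given to `i`, so its last such slot decides. -/
theorem work_le_of_forall {σ : Schedule n} {T m : ℕ} {i : Fin n}
    (h : ∀ s < T, σ s = some i → work σ (s + 1) i ≤ m) : work σ T i ≤ m := by
  induction T with
  | zero => simp [work_zero]
  | succ T ih =>
    by_cases hT : σ T = some i
    · exact h T (by omega) hT
    · rw [work_succ_of_ne hT]
      exact ih fun s hs => h s (by omega)

section OnlyActive

variable {I : Instance n} {σ : Schedule n}

theorem OnlyActive.work_le_size (h : OnlyActive I σ) (t : ℕ) (i : Fin n) :
    work σ t i ≤ I.size i := by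
  refine work_le_of_forall fun s _ hs => ?_
  have := (h s i hs).2
  rw [work_succ_of_eq hs]
  unfold remaining at this
  omega

theorem OnlyActive.remaining_add_work (h : OnlyActive I σ) (t : ℕ) (i : Fin n) :
    remaining I σ t i + work σ t i = I.size i :=
  Nat.sub_add_cancel (h.work_le_size t i)

theorem OnlyActive.work_le_sub (h : OnlyActive I σ) (t : ℕ) (i : Fin n) :
    work σ t i ≤ t - I.release i := by
  induction t with
  | zero => simp [work_zero]
  | succ t ih =>
    by_cases ht : σ t = some i
    · have := (h t i ht).1
      rw [work_succ_of_eq ht]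
      omega
    · rw [work_succ_of_ne ht]
      omega

theorem OnlyActive.work_eq_zero (h : OnlyActive I σ) {t : ℕ} {i : Fin n} (ht : t ≤ I.release i) :
    work σ t i = 0 := by
  have := h.work_le_sub t i
  omega

end OnlyActive

theorem remaining_anti (I : Instance n) (σ : Schedule n) (i : Fin n) :
    Antitone fun t => remaining I σ t i :=
  fun _ _ h => Nat.sub_le_sub_left (work_mono σ i h) _

theorem remaining_le_size (I : Instance n) (σ : Schedule n) (t : ℕ) (i : Fin n) :
    remaining I σ t i ≤ I.size i := Nat.sub_le _ _

/-! ### Completion and flow times of feasible schedules. -/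

section Feasible

variable {I : Instance n} {σ : Schedule n}

theorem IsFeasible.onlyActive (h : IsFeasible I σ) : OnlyActive I σ := h.1

theorem IsFeasible.remaining_completionTime (h : IsFeasible I σ) (i : Fin n) :
    remaining I σ (completionTime I σ i) i = 0 :=
  Nat.sInf_mem (s := {t | remaining I σ t i = 0}) (h.2 i)

theorem remaining_pos_of_lt_completionTime {t : ℕ} {i : Fin n} (ht : t < completionTime I σ i) :
    0 < remaining I σ t i :=
  Nat.pos_of_ne_zero fun h0 => Nat.notMem_of_lt_sInf ht h0

theorem IsFeasible.remaining_eq_zero_iff (h : IsFeasible I σ) {t : ℕ} {i : Fin n} :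
    remaining I σ t i = 0 ↔ completionTime I σ i ≤ t := by
  constructor
  · intro h0
    by_contra hlt
    have := remaining_pos_of_lt_completionTime (I := I) (σ := σ) (i := i) (not_le.1 hlt)
    omega
  · intro hle
    have := remaining_anti I σ i hle
    have h0 := h.remaining_completionTime i
    simp only at this
    omega

theorem IsFeasible.release_add_size_le (h : IsFeasible I σ) (i : Fin n) :
    I.release i + I.size i ≤ completionTime I σ i := by
  have h1 := h.onlyActive.work_le_sub (completionTime I σ i) i
  have h2 := h.onlyActive.remaining_add_work (completionTime I σ i) i
  have h3 := h.remaining_completionTime i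
  have h4 := I.size_pos i
  omega

/-- The flow time, as a natural number. -/
noncomputable def natFlow (I : Instance n) (σ : Schedule n) (i : Fin n) : ℕ :=
  completionTime I σ i - I.release i

theorem IsFeasible.completionTime_eq (h : IsFeasible I σ) (i : Fin n) :
    completionTime I σ i = I.release i + natFlow I σ i := by
  have := h.release_add_size_le i
  unfold natFlow
  omega

theorem IsFeasible.size_le_natFlow (h : IsFeasible I σ) (i : Fin n) :
    I.size i ≤ natFlow I σ i := by
  have := h.release_add_size_le i
  unfold natFlow
  omega

theorem IsFeasible.flowTime_eq (h : IsFeasible I σ) (i : Fin n) :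
    flowTime I σ i = natFlow I σ i := by
  rw [flowTime, h.completionTime_eq]
  push_cast
  ring

end Feasible

/-! ### Exchange argument for SRPT and its optimality properties. -/

section SRPT

variable {I : Instance n} {ρ σ : Schedule n}

theorem IsSRPTSchedule.onlyActive (h : IsSRPTSchedule I ρ) : OnlyActive I ρ :=
  fun t i hi => ((h t).1 i hi).1

theorem OnlyActive.remaining_succ (h : OnlyActive I σ) (t : ℕ) (i : Fin n) :
    remaining I σ t i = remaining I σ (t + 1) i + if σ t = some i then 1 else 0 := by
  have h1 := h.remaining_add_work t i
  have h2 := h.remaining_add_work (t + 1) i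
  rw [work_succ] at h2
  omega

theorem OnlyActive.sum_remaining_succ (h : OnlyActive I σ) (t : ℕ) (s : Finset (Fin n)) :
    ∑ i ∈ s, remaining I σ t i =
      ∑ i ∈ s, remaining I σ (t + 1) i + if ∃ i ∈ s, σ t = some i then 1 else 0 := by
  rw [Finset.sum_congr rfl fun i _ => h.remaining_succ t i, Finset.sum_add_distrib]
  congr 1
  split_ifs with hex
  · obtain ⟨k, hk, hkt⟩ := hex
    rw [Finset.sum_eq_single_of_mem k hk]
    · simp [hkt]
    · intro j _ hj
      rw [hkt, if_neg]
      simpa using hj.symm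
  · refine Finset.sum_eq_zero fun i hi => if_neg fun hc => hex ⟨i, hi, hc⟩

/-- SRPT maximizes, for each `k`, the volume of the `k` largest remaining jobs: removing any jobs
from what `σ` has left, one can remove as many jobs from what SRPT has left so that the rest is no
larger. -/
theorem IsSRPTSchedule.exists_removal (hρ : IsSRPTSchedule I ρ) (hσ : OnlyActive I σ) (t : ℕ)
    (A : Finset (Fin n)) :
    ∃ B : Finset (Fin n), B.card ≤ A.card ∧ (∀ i, t < I.release i → (i ∈ B ↔ i ∈ A)) ∧
      ∑ i ∈ Bᶜ, remaining I ρ t i ≤ ∑ i ∈ Aᶜ, remaining I σ t i := by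
  have hρa := hρ.onlyActive
  induction t with
  | zero => exact ⟨A, le_rfl, fun _ _ => Iff.rfl, by simp [remaining, work_zero]⟩
  | succ t ih =>
    obtain ⟨B, hcard, hunrel, hsum⟩ := ih
    have e1 := hσ.sum_remaining_succ t Aᶜ
    have e2 := hρa.sum_remaining_succ t Bᶜ
    by_cases hA : ∃ i ∈ Aᶜ, σ t = some i
    swap
    · rw [if_neg hA] at e1
      exact ⟨B, hcard, fun i hi => hunrel i (by omega), by omega⟩
    rw [if_pos hA] at e1
    by_cases hB : ∃ i ∈ Bᶜ, ρ t = some i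
    · rw [if_pos hB] at e2
      exact ⟨B, hcard, fun i hi => hunrel i (by omega), by omega⟩
    rw [if_neg hB] at e2
    by_cases hact : ∃ c ∈ Bᶜ, Active I ρ t c
    · obtain ⟨c, hcB, hc⟩ := hact
      obtain ⟨b, hb⟩ : ∃ b, ρ t = some b := by
        by_contra hno
        exact (hρ t).2 (Option.eq_none_iff_forall_ne_some.2 fun b hb => hno ⟨b, hb⟩) c hc
      have hbB : b ∈ B := by
        by_contra hbB
        exact hB ⟨b, by simpa using hbB, hb⟩
      have hcB' : c ∉ B := by simpa using hcB
      have hbc : b ≠ c := fun h => hcB' (h ▸ hbB)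
      have hmin := ((hρ t).1 b hb).2 c hc
      have hbact := hρa t b hb
      -- SRPT preferred `b` to `c`, so after this slot `b` has strictly less left than `c`. Trading
      -- `b` for `c` in the removed set therefore lowers the sum by at least one.
      refine ⟨insert c (B.erase b), ?_, ?_, ?_⟩
      · rw [Finset.card_insert_of_notMem (by simp [hcB']), Finset.card_erase_of_mem hbB]
        have := Finset.card_pos.2 ⟨b, hbB⟩
        omega
      · intro i hi
        have h1 : i ≠ c := by
          rintro rfl
          have := hc.1
          omega
        have h2 : i ≠ b := by
          rintro rfl
          have := hbact.1
          omega
        simp [h1, h2, hunrel i (by omega)]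
      · have hcompl : (insert c (B.erase b))ᶜ = insert b (Bᶜ.erase c) := by
          ext i
          by_cases h1 : i = b
          · subst h1
            simp [hbc]
          · simp [h1]
        rw [hcompl, Finset.sum_insert (by simp [hbc, hbB])]
        have h3 := Finset.add_sum_erase Bᶜ (fun i => remaining I ρ (t + 1) i) hcB
        have h4 := hρa.remaining_succ t b
        have h5 := hρa.remaining_succ t c
        rw [hb] at h4 h5
        simp only [if_true] at h4
        rw [if_neg (by simpa using hbc)] at h5
        omega
    -- Outside `B` only unreleased jobs have tasks left. There `A` and `B` agree, which is why the
    -- induction carries that clause, and `σ` has not touched these jobs.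
    · refine ⟨B, hcard, fun i hi => hunrel i (by omega), ?_⟩
      have hsub : ∀ i, i ∈ Bᶜ → remaining I ρ (t + 1) i ≤ if t < I.release i then I.size i else 0 := by
        intro i hi
        split_ifs with hr
        · exact remaining_le_size _ _ _ _
        · have hna : ¬ Active I ρ t i := fun h => hact ⟨i, hi, h⟩
          have h0 : remaining I ρ t i = 0 := by
            by_contra h0
            exact hna ⟨not_lt.1 hr, Nat.pos_of_ne_zero h0⟩
          have := remaining_anti I ρ i (Nat.le_succ t)
          simp only [Nat.succ_eq_add_one] at this
          omega
      calc ∑ i ∈ Bᶜ, remaining I ρ (t + 1) i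
          ≤ ∑ i ∈ Bᶜ, if t < I.release i then I.size i else 0 := Finset.sum_le_sum hsub
        _ = ∑ i ∈ Aᶜ, if t < I.release i then I.size i else 0 := by
            rw [← Finset.sum_filter, ← Finset.sum_filter]
            refine Finset.sum_congr ?_ fun _ _ => rfl
            ext i
            simp only [Finset.mem_filter, Finset.mem_compl]
            exact and_congr_left fun hr => not_congr (hunrel i hr)
        _ ≤ ∑ i ∈ Aᶜ, remaining I σ (t + 1) i := by
            refine Finset.sum_le_sum fun i _ => ?_
            split_ifs with hr
            · have h1 := hσ.work_eq_zero (t := t + 1) (i := i) hr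
              unfold remaining
              omega
            · exact Nat.zero_le _

theorem OnlyActive.sum_remaining_add_sum_work (h : OnlyActive I σ) (t : ℕ) :
    ∑ i, remaining I σ t i + ∑ i, work σ t i = ∑ i, I.size i := by
  rw [← Finset.sum_add_distrib]
  exact Finset.sum_congr rfl fun i _ => h.remaining_add_work t i

theorem IsSRPTSchedule.sum_work_le (hρ : IsSRPTSchedule I ρ) (hσ : OnlyActive I σ) (t : ℕ) :
    ∑ i, work σ t i ≤ ∑ i, work ρ t i := by
  obtain ⟨B, hB, -, hsum⟩ := hρ.exists_removal hσ t ∅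
  obtain rfl : B = ∅ := by simpa using hB
  have h1 := hσ.sum_remaining_add_sum_work t
  have h2 := hρ.onlyActive.sum_remaining_add_sum_work t
  simp only [Finset.compl_empty] at hsum
  omega

/-- `exists_removal` restricted to the jobs released by time `t`. -/
theorem IsSRPTSchedule.exists_removal_released (hρ : IsSRPTSchedule I ρ) (hσ : OnlyActive I σ)
    (t : ℕ) (A : Finset (Fin n)) :
    ∃ B : Finset (Fin n), B.card ≤ A.card ∧
      ∑ i with I.release i ≤ t ∧ i ∉ B, remaining I ρ t i ≤
        ∑ i with I.release i ≤ t ∧ i ∉ A, remaining I σ t i := by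
  -- Removing all unreleased jobs along with `A` forces them into `B`; they can then be discarded
  -- from both sides without spoiling the cardinality bound.
  set N : Finset (Fin n) := {i | t < I.release i} with hN
  obtain ⟨B, hcard, hunrel, hsum⟩ := hρ.exists_removal hσ t (A ∪ N)
  have hNB : N ⊆ B := fun i hi => (hunrel i (by simpa [hN] using hi)).2 (Finset.mem_union_right _ hi)
  refine ⟨B \ N, ?_, ?_⟩
  · rw [Finset.card_sdiff_of_subset hNB]
    have := Finset.card_union_le A N
    omega
  · have h1 : (Finset.univ.filter fun i => I.release i ≤ t ∧ i ∉ B \ N) = Bᶜ := by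
      ext i
      simp only [Finset.mem_filter, Finset.mem_univ, true_and, Finset.mem_sdiff, Finset.mem_compl,
        not_and, not_not]
      constructor
      · rintro ⟨h1, h2⟩ hB
        have := h2 hB
        simp only [hN, Finset.mem_filter, Finset.mem_univ, true_and] at this
        omega
      · intro hB
        refine ⟨?_, fun h => absurd h hB⟩
        by_contra hlt
        exact hB (hNB (by simpa [hN] using hlt))
    have h2 : (Finset.univ.filter fun i => I.release i ≤ t ∧ i ∉ A) = (A ∪ N)ᶜ := by
      ext i
      simp [hN, and_comm]
    rw [h1, h2]
    exact hsum

end SRPT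

section SRPT

variable {I : Instance n} {ρ σ : Schedule n}

/-- SRPT minimizes the number of active jobs at each time. -/
theorem IsSRPTSchedule.card_active_le (hρ : IsSRPTSchedule I ρ) (hσ : OnlyActive I σ) (t : ℕ) :
    (Finset.univ.filter fun i => I.release i ≤ t ∧ 0 < remaining I ρ t i).card ≤
      (Finset.univ.filter fun i => I.release i ≤ t ∧ 0 < remaining I σ t i).card := by
  -- With every active job of `σ` removed, nothing is left on the right, so every active job of SRPT
  -- lies in `B`.
  obtain ⟨B, hcard, hsum⟩ := hρ.exists_removal_released hσ t
    (Finset.univ.filter fun i => I.release i ≤ t ∧ 0 < remaining I σ t i)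
  refine le_trans (Finset.card_le_card fun i hi => ?_) hcard
  by_contra hiB
  simp only [Finset.mem_filter, Finset.mem_univ, true_and] at hi
  rw [Finset.sum_eq_zero (s := Finset.univ.filter fun i => I.release i ≤ t ∧
    i ∉ Finset.univ.filter fun i => I.release i ≤ t ∧ 0 < remaining I σ t i)] at hsum
  · have := Finset.single_le_sum (f := fun i => remaining I ρ t i) (fun _ _ => Nat.zero_le _)
      (show i ∈ Finset.univ.filter fun i => I.release i ≤ t ∧ i ∉ B by simp [hi.1, hiB])
    omega
  · intro j hj
    simp only [Finset.mem_filter, Finset.mem_univ, true_and, not_and, not_lt] at hj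
    have := hj.2 hj.1
    omega

/-- If the instance can be completed at all, SRPT completes it. -/
theorem IsSRPTSchedule.isFeasible (hρ : IsSRPTSchedule I ρ) (hσ : IsFeasible I σ) :
    IsFeasible I ρ := by
  refine ⟨hρ.onlyActive, fun i => ⟨Finset.univ.sup (completionTime I σ), ?_⟩⟩
  set T := Finset.univ.sup (completionTime I σ)
  have hT : ∀ j, completionTime I σ j ≤ T := fun j => Finset.le_sup (Finset.mem_univ j)
  have hcard := hρ.card_active_le hσ.onlyActive T
  have h0 : (Finset.univ.filter fun i => I.release i ≤ T ∧ 0 < remaining I σ T i) = ∅ := by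
    refine Finset.filter_eq_empty_iff.2 fun j _ hj => ?_
    have := hσ.remaining_eq_zero_iff.2 (hT j)
    omega
  rw [h0, Finset.card_empty, Nat.le_zero, Finset.card_eq_zero] at hcard
  have hi := Finset.filter_eq_empty_iff.1 hcard (Finset.mem_univ i)
  have h1 := hσ.release_add_size_le i
  have h2 := hT i
  by_contra hne
  exact hi ⟨by omega, by omega⟩

theorem IsFeasible.natFlow_eq_card (h : IsFeasible I σ) {T : ℕ} {i : Fin n}
    (hT : completionTime I σ i ≤ T) :
    natFlow I σ i =
      ((Finset.range T).filter fun t => I.release i ≤ t ∧ 0 < remaining I σ t i).card := by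
  have : ((Finset.range T).filter fun t => I.release i ≤ t ∧ 0 < remaining I σ t i) =
      Finset.Ico (I.release i) (completionTime I σ i) := by
    ext t
    have := h.remaining_eq_zero_iff (t := t) (i := i)
    simp only [Finset.mem_filter, Finset.mem_range, Finset.mem_Ico]
    omega
  rw [this, Nat.card_Ico, natFlow]

theorem IsFeasible.sum_natFlow_eq (h : IsFeasible I σ) {T : ℕ}
    (hT : ∀ i, completionTime I σ i ≤ T) :
    ∑ i, natFlow I σ i = ∑ t ∈ Finset.range T,
      (Finset.univ.filter fun i => I.release i ≤ t ∧ 0 < remaining I σ t i).card := by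
  rw [Finset.sum_congr rfl fun i _ => h.natFlow_eq_card (hT i)]
  simp only [Finset.card_filter]
  exact Finset.sum_comm

/-- SRPT minimizes the total flow time. -/
theorem IsSRPTSchedule.sum_natFlow_le (hρ : IsSRPTSchedule I ρ) (hσ : IsFeasible I σ) :
    ∑ i, natFlow I ρ i ≤ ∑ i, natFlow I σ i := by
  set T := max (Finset.univ.sup (completionTime I σ)) (Finset.univ.sup (completionTime I ρ))
  have h1 : ∀ j, completionTime I σ j ≤ T :=
    fun j => (Finset.le_sup (Finset.mem_univ j)).trans (le_max_left _ _)
  have h2 : ∀ j, completionTime I ρ j ≤ T :=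
    fun j => (Finset.le_sup (Finset.mem_univ j)).trans (le_max_right _ _)
  rw [(hρ.isFeasible hσ).sum_natFlow_eq h2, hσ.sum_natFlow_eq h1]
  exact Finset.sum_le_sum fun t _ => hρ.card_active_le hσ.onlyActive t

end SRPT

/-! ### From the recursive definition of BAL(θ) to properties of its whole schedule. -/

section Spec

variable {I : Instance n} {θ : ℝ} {ρ : Schedule n}

theorem balHistory_eq {s t : ℕ} (h : s < t) :
    balHistory I θ ρ t s = balSchedule I θ ρ s := by
  induction t, h using Nat.le_induction with
  | base => simp [balHistory, balSchedule]
  | succ t ht ih => rw [balHistory, Function.update_of_ne (by omega), ih]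

theorem mem_starvingSet {b : Schedule n} {t : ℕ} {i : Fin n} : i ∈ starvingSet I θ b t ↔
    Active I b t i ∧ ∃ s ≤ t, MeetsThreshold I θ b s i := by
  simp [starvingSet]

section Congr

variable {σ τ : Schedule n} {t : ℕ}

theorem meetsThreshold_congr_schedule (h : ∀ s < t, σ s = τ s) {s : ℕ} (hs : s ≤ t) (i : Fin n) :
    MeetsThreshold I θ σ s i ↔ MeetsThreshold I θ τ s i := by
  have := work_congr (fun u hu => h u (lt_of_lt_of_le hu hs)) i
  simp only [MeetsThreshold, Active, waitRatio, remaining, this]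

theorem starvingSet_congr_schedule (h : ∀ s < t, σ s = τ s) :
    starvingSet I θ σ t = starvingSet I θ τ t := by
  ext i
  have hw := work_congr h i
  simp only [mem_starvingSet, Active, remaining, hw]
  refine and_congr_right fun _ => ?_
  exact exists_congr fun s => and_congr_right fun hs => meetsThreshold_congr_schedule h hs i

/-- The infimum is attained by time `t`, so later slots, where the schedules may differ, do not
affect it. -/
theorem starvingTime_congr_schedule (h : ∀ s < t, σ s = τ s) {i : Fin n}
    (hi : i ∈ starvingSet I θ σ t) : starvingTime I θ σ i = starvingTime I θ τ i := by
  simp only [starvingSet, Finset.mem_filter] at hi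
  obtain ⟨-, -, s, hs, hm⟩ := hi
  have hm' := (meetsThreshold_congr_schedule h hs i).1 hm
  have h1 : starvingTime I θ σ i ≤ t := (Nat.sInf_le hm).trans hs
  have h2 : starvingTime I θ τ i ≤ t := (Nat.sInf_le hm').trans hs
  refine le_antisymm (Nat.sInf_le ?_) (Nat.sInf_le ?_)
  · exact (meetsThreshold_congr_schedule h h2 i).2
      (Nat.sInf_mem (s := {t | MeetsThreshold I θ τ t i}) ⟨s, hm'⟩)
  · exact (meetsThreshold_congr_schedule h h1 i).1
      (Nat.sInf_mem (s := {t | MeetsThreshold I θ σ t i}) ⟨s, hm⟩)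

end Congr

theorem exists_of_balStep {σ : Schedule n} {t : ℕ} (h : (starvingSet I θ σ t).Nonempty) :
    ∃ i ∈ starvingSet I θ σ t, balStep I θ ρ σ t = some i ∧
      ∀ j ∈ starvingSet I θ σ t, starvingTime I θ σ i ≤ starvingTime I θ σ j := by
  have hspec :=
    (Finset.exists_min_image (starvingSet I θ σ t) (starvingKey I θ σ) h).choose_spec
  refine ⟨_, hspec.1, by rw [balStep, dif_pos h], fun j hj => ?_⟩
  have := hspec.2 j hj
  unfold starvingKey at this
  rcases Prod.Lex.toLex_le_toLex.1 this with h1 | h1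
  · exact h1.le
  · exact h1.1.le

/-- The properties of the schedules of `BAL(θ)`. -/
structure IsBALSchedule (I : Instance n) (θ : ℝ) (ρ b : Schedule n) : Prop where
  starving : ∀ t, (starvingSet I θ b t).Nonempty → ∃ i ∈ starvingSet I θ b t, b t = some i ∧
    ∀ j ∈ starvingSet I θ b t, starvingTime I θ b i ≤ starvingTime I θ b j
  normal : ∀ t, ¬ (starvingSet I θ b t).Nonempty → ∀ s ≤ t, Pending ρ b t s →
    ∃ u ≤ s, Pending ρ b t u ∧ b t = ρ u
  idle : ∀ t, ¬ (starvingSet I θ b t).Nonempty → (∀ s ≤ t, ¬ Pending ρ b t s) → b t = none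

theorem isBALSchedule (I : Instance n) (θ : ℝ) (ρ : Schedule n) :
    IsBALSchedule I θ ρ (balSchedule I θ ρ) := by
  classical
  have hagree : ∀ t, ∀ s < t, balHistory I θ ρ t s = balSchedule I θ ρ s :=
    fun t s hs => balHistory_eq hs
  have hset := fun t => starvingSet_congr_schedule (I := I) (θ := θ) (hagree t)
  have hpend : ∀ t s, Pending ρ (balHistory I θ ρ t) t s ↔ Pending ρ (balSchedule I θ ρ) t s := by
    intro t s
    simp only [Pending, work_congr (hagree t)]
  have hstep : ∀ t, balSchedule I θ ρ t = balStep I θ ρ (balHistory I θ ρ t) t := fun _ => rfl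
  refine ⟨fun t h => ?_, fun t h s hs hp => ?_, fun t h hp => ?_⟩
  · rw [← hset] at h
    obtain ⟨i, hi, hbi, hmin⟩ := exists_of_balStep (ρ := ρ) h
    refine ⟨i, hset t ▸ hi, hbi, fun j hj => ?_⟩
    rw [← hset] at hj
    rw [← starvingTime_congr_schedule (hagree t) hi, ← starvingTime_congr_schedule (hagree t) hj]
    exact hmin j hj
  · rw [← hset] at h
    have hP : ∃ s, s ≤ t ∧ Pending ρ (balHistory I θ ρ t) t s := ⟨s, hs, (hpend t s).2 hp⟩
    refine ⟨Nat.find hP, Nat.find_min' hP ⟨hs, (hpend t s).2 hp⟩,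
      (hpend t _).1 (Nat.find_spec hP).2, ?_⟩
    rw [hstep, balStep, dif_neg h, dif_pos hP]
  · rw [← hset] at h
    have hP : ¬ ∃ s, s ≤ t ∧ Pending ρ (balHistory I θ ρ t) t s := by
      rintro ⟨s, hs, hp'⟩
      exact hp s hs ((hpend t s).1 hp')
    rw [hstep, balStep, dif_neg h, dif_neg hP]

end Spec

/-! ### Feasibility and total work of BAL(θ). -/

section BALSchedule

variable {I : Instance n} {θ : ℝ} {ρ b : Schedule n}

theorem meetsThreshold_starvingTime {i : Fin n} (h : ∃ t, MeetsThreshold I θ b t i) :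
    MeetsThreshold I θ b (starvingTime I θ b i) i :=
  Nat.sInf_mem (s := {t | MeetsThreshold I θ b t i}) h

theorem starvingTime_le {i : Fin n} {t : ℕ} (h : i ∈ starvingSet I θ b t) :
    starvingTime I θ b i ≤ t := by
  obtain ⟨-, s, hs, hm⟩ := mem_starvingSet.1 h
  exact (Nat.sInf_le hm).trans hs

theorem exists_meetsThreshold {i : Fin n} {t : ℕ} (h : i ∈ starvingSet I θ b t) :
    ∃ t, MeetsThreshold I θ b t i := by
  obtain ⟨-, s, -, hm⟩ := mem_starvingSet.1 h
  exact ⟨s, hm⟩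

/-- A slot of `b` executes a starving job or a pending task of `ρ`. -/
theorem IsBALSchedule.mem_or_pending (hb : IsBALSchedule I θ ρ b) {t : ℕ} {i : Fin n}
    (h : b t = some i) :
    i ∈ starvingSet I θ b t ∨
      ¬ (starvingSet I θ b t).Nonempty ∧ ∃ s ≤ t, ρ s = some i ∧ work b t i < work ρ (s + 1) i := by
  by_cases hST : (starvingSet I θ b t).Nonempty
  · obtain ⟨j, hj, hbj, -⟩ := hb.starving t hST
    left
    rw [h] at hbj
    obtain rfl : i = j := by simpa using hbj
    exact hj
  · right
    by_cases hP : ∃ s ≤ t, Pending ρ b t s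
    · obtain ⟨s, hs, hp⟩ := hP
      obtain ⟨u, hu, ⟨j, hj, hlt⟩, hbu⟩ := hb.normal t hST s hs hp
      rw [h, hj] at hbu
      obtain rfl : i = j := by simpa using hbu
      exact ⟨hST, u, hu.trans hs, hj, hlt⟩
    · have := hb.idle t hST fun s hs hp => hP ⟨s, hs, hp⟩
      simp [this] at h

theorem IsBALSchedule.onlyActive (hb : IsBALSchedule I θ ρ b) (hρ : OnlyActive I ρ) :
    OnlyActive I b := by
  intro t i h
  rcases hb.mem_or_pending h with hi | ⟨-, s, hs, hsi, hlt⟩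
  · exact (mem_starvingSet.1 hi).1
  · have h1 := (hρ s i hsi).1
    have h2 := hρ.work_le_size (s + 1) i
    refine ⟨h1.trans hs, ?_⟩
    unfold remaining
    omega

/-- An unfinished job would eventually starve forever and keep the machine busy, and more tasks
would be executed than exist. -/
theorem IsBALSchedule.isFeasible (hb : IsBALSchedule I θ ρ b) (hρ : OnlyActive I ρ) :
    IsFeasible I b := by
  have hba := hb.onlyActive hρ
  refine ⟨hba, fun i => ?_⟩
  by_contra hno
  have hpos : ∀ t, 0 < remaining I b t i := fun t => Nat.pos_of_ne_zero fun h => hno ⟨t, h⟩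
  obtain ⟨N, hN⟩ := exists_nat_ge (|θ| * I.size i)
  set a := I.release i + N
  have hm : MeetsThreshold I θ b a i := by
    refine ⟨⟨Nat.le_add_right _ _, hpos a⟩, ?_⟩
    have h1 : (0 : ℝ) < remaining I b a i := by exact_mod_cast hpos a
    have h2 : (remaining I b a i : ℝ) ≤ I.size i := by exact_mod_cast remaining_le_size I b a i
    rw [waitRatio, le_div_iff₀ h1]
    calc θ * (remaining I b a i : ℝ) ≤ |θ| * remaining I b a i := by gcongr; exact le_abs_self θ
      _ ≤ |θ| * I.size i := by gcongr
      _ ≤ N := hN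
      _ = (a : ℝ) - I.release i := by simp [a]
  have hbusy : ∀ t, a ≤ t → b t ≠ none := by
    intro t ht
    obtain ⟨j, -, hj, -⟩ := hb.starving t ⟨i, mem_starvingSet.2
      ⟨⟨hm.1.1.trans ht, hpos t⟩, a, ht, hm⟩⟩
    simp [hj]
  set c := a + (∑ j, I.size j) + 1
  have h1 := sum_work_add_of_busy (a := a) (c := c) (by omega) fun t h _ => hbusy t h
  have h2 : ∑ j, work b c j ≤ ∑ j, I.size j := Finset.sum_le_sum fun j _ => hba.work_le_size c j
  omega

/-- `BAL(θ)` has never executed fewer tasks than SRPT. -/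
theorem IsBALSchedule.sum_work_le (hb : IsBALSchedule I θ ρ b) (t : ℕ) :
    ∑ i, work ρ t i ≤ ∑ i, work b t i := by
  induction t with
  | zero => simp [work_zero]
  | succ t ih =>
    by_cases hidle : b t = none
    -- An idle slot has no pending task, so each task that SRPT executes through slot `t` is already
    -- done.
    · refine Finset.sum_le_sum fun i _ => (?_ : _ ≤ work b t i).trans (work_mono b i (Nat.le_succ t))
      refine work_le_of_forall fun s hs hsi => ?_
      by_contra hlt
      by_cases hST : (starvingSet I θ b t).Nonempty
      · obtain ⟨j, -, hj, -⟩ := hb.starving t hST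
        simp [hj] at hidle
      · obtain ⟨u, -, ⟨j, hj, -⟩, hbu⟩ := hb.normal t hST s (by omega) ⟨i, hsi, not_le.1 hlt⟩
        simp [hbu, hj] at hidle
    · rw [sum_work_succ, sum_work_succ, if_neg hidle]
      split_ifs <;> omega

end BALSchedule

/-! ### Unfinished volume. -/

section Volume

variable {I : Instance n} {σ τ : Schedule n}

/-- Neither schedule has touched an unreleased job, so the whole difference in work lies in the
released ones. -/
theorem OnlyActive.sum_released_remaining_le (hσ : OnlyActive I σ) (hτ : OnlyActive I τ) {t : ℕ}
    (h : ∑ i, work σ t i ≤ ∑ i, work τ t i) :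
    ∑ i with I.release i ≤ t, remaining I τ t i ≤
      ∑ i with I.release i ≤ t, remaining I σ t i := by
  have h1 := hσ.sum_remaining_add_sum_work t
  have h2 := hτ.sum_remaining_add_sum_work t
  have e1 := Finset.sum_filter_add_sum_filter_not Finset.univ (fun i => I.release i ≤ t)
    (remaining I σ t)
  have e2 := Finset.sum_filter_add_sum_filter_not Finset.univ (fun i => I.release i ≤ t)
    (remaining I τ t)
  have e3 : ∑ i with ¬ I.release i ≤ t, remaining I σ t i =
      ∑ i with ¬ I.release i ≤ t, remaining I τ t i := by
    refine Finset.sum_congr rfl fun i hi => ?_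
    have hi' : t ≤ I.release i := by
      simp only [Finset.mem_filter, Finset.mem_univ, true_and] at hi
      omega
    simp [remaining, hσ.work_eq_zero hi', hτ.work_eq_zero hi']
  omega

theorem sum_work_add_le (σ : Schedule n) (a u : ℕ) :
    ∑ i, work σ (a + u) i ≤ ∑ i, work σ a i + u := by
  induction u with
  | zero => simp
  | succ u ih =>
    rw [← add_assoc, sum_work_succ]
    split_ifs <;> omega

/-- The total unfinished volume over time is at most the sum of the squared flow times. -/
theorem IsFeasible.sum_volume_le (hσ : IsFeasible I σ) (T : ℕ) :
    ∑ t ∈ Finset.range T, ∑ i with I.release i ≤ t, remaining I σ t i ≤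
      ∑ i, natFlow I σ i ^ 2 := by
  simp only [Finset.sum_filter]
  rw [Finset.sum_comm]
  refine Finset.sum_le_sum fun i _ => ?_
  rw [← Finset.sum_filter]
  calc ∑ t ∈ Finset.range T with I.release i ≤ t, remaining I σ t i
      ≤ ∑ t ∈ Finset.Ico (I.release i) (completionTime I σ i), remaining I σ t i := by
        refine Finset.sum_le_sum_of_ne_zero fun t ht h0 => ?_
        rw [Ne, hσ.remaining_eq_zero_iff] at h0
        simp only [Finset.mem_filter] at ht
        simp only [Finset.mem_Ico]
        omega
    _ ≤ (Finset.Ico (I.release i) (completionTime I σ i)).card • natFlow I σ i :=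
        Finset.sum_le_card_nsmul _ _ _ fun t _ =>
          (remaining_le_size I σ t i).trans (hσ.size_le_natFlow i)
    _ = natFlow I σ i ^ 2 := by
        rw [Nat.card_Ico, smul_eq_mul, sq]
        rfl

end Volume

/-- The elements of `U` dominate `0, 1, …, |U| - 1` in order, and the first `|U|` odd numbers sum to
`|U|²`. -/
theorem card_sq_le_sum_odd (U : Finset ℕ) : U.card ^ 2 ≤ ∑ u ∈ U, (2 * u + 1) := by
  induction U using Finset.induction_on_max with
  | empty => simp
  | insert m s hm ih =>
    have hms : m ∉ s := fun h => lt_irrefl _ (hm m h)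
    have hcard : s.card ≤ m := by
      simpa using Finset.card_le_card (fun x hx => Finset.mem_range.2 (hm x hx) : s ⊆ Finset.range m)
    rw [Finset.card_insert_of_notMem hms, Finset.sum_insert hms]
    nlinarith

theorem sum_range_odd (m : ℕ) : ∑ u ∈ Finset.range m, (2 * u + 1) = m ^ 2 := by
  induction m with
  | zero => simp
  | succ m ih =>
    rw [Finset.sum_range_succ, ih]
    ring

/-! ### A lower bound for every schedule from what SRPT has left. -/

section Tradeoff

variable {I : Instance n} {ρ σ : Schedule n}

/-- If at time `a` SRPT has at least `x i` tasks left of each job `i`, then no schedule can do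
well on these jobs, unless the `x i` are very uneven. -/
theorem IsSRPTSchedule.mul_sum_sq_le (hρ : IsSRPTSchedule I ρ) (hσ : IsFeasible I σ) {a : ℕ}
    {x : Fin n → ℕ} (hrel : ∀ i, x i ≠ 0 → I.release i ≤ a)
    (hx : ∀ i, x i ≤ remaining I ρ a i) {s : ℝ} (hs : 0 ≤ s) :
    s * (∑ i, (x i : ℝ)) ^ 2 ≤ s ^ 2 * ∑ i, (x i : ℝ) ^ 2 + ∑ i, (natFlow I σ i : ℝ) ^ 2 := by
  set A : ℕ → Finset (Fin n) := fun u =>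
    Finset.univ.filter fun i => I.release i ≤ a ∧ a + u < completionTime I σ i with hA
  choose B hcard hsum using fun u => hρ.exists_removal_released hσ.onlyActive a (A u)
  set P := ∑ i, x i with hP
  -- Jobs outside `A u` are finished by `σ` within `u` slots after `a`, so they hold at most `u`
  -- tasks at time `a`; the removal lemma transfers this bound to `x`.
  have hsmall : ∀ u, ∑ i ∈ (B u)ᶜ, x i ≤ u := by
    intro u
    calc ∑ i ∈ (B u)ᶜ, x i ≤ ∑ i with I.release i ≤ a ∧ i ∉ B u, x i := by
          refine Finset.sum_le_sum_of_ne_zero fun i hi h0 => ?_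
          simpa using ⟨hrel i h0, by simpa using hi⟩
      _ ≤ ∑ i with I.release i ≤ a ∧ i ∉ B u, remaining I ρ a i :=
          Finset.sum_le_sum fun i _ => hx i
      _ ≤ ∑ i with I.release i ≤ a ∧ i ∉ A u, remaining I σ a i := hsum u
      _ ≤ ∑ i with I.release i ≤ a ∧ i ∉ A u, (work σ (a + u) i - work σ a i) := by
          refine Finset.sum_le_sum fun i hi => ?_
          simp only [hA, Finset.mem_filter, Finset.mem_univ, true_and, not_and, not_lt] at hi
          have h1 := hσ.remaining_eq_zero_iff.2 (hi.2 hi.1)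
          have h2 := hσ.onlyActive.remaining_add_work a i
          have h3 := hσ.onlyActive.remaining_add_work (a + u) i
          omega
      _ ≤ ∑ i, (work σ (a + u) i - work σ a i) :=
          Finset.sum_le_sum_of_subset (Finset.subset_univ _)
      _ ≤ u := by
          have h1 := sum_work_add_le σ a u
          have h2 : ∑ i, (work σ (a + u) i - work σ a i) + ∑ i, work σ a i =
              ∑ i, work σ (a + u) i := by
            rw [← Finset.sum_add_distrib]
            exact Finset.sum_congr rfl fun i _ =>
              Nat.sub_add_cancel (work_mono σ i (Nat.le_add_right a u))
          omega
  -- `m i` plays the role of a flow time: summing `∑ i ∈ B u, x i ≥ P - u` over `u < P` bounds `∑ m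
  -- i * x i` below by `P² / 2`.
  set m : Fin n → ℕ := fun i => ((Finset.range P).filter fun u => i ∈ B u).card with hm
  have hcount : P ^ 2 ≤ 2 * ∑ i, m i * x i := by
    have h1 : ∀ u ∈ Finset.range P, P ≤ u + ∑ i ∈ B u, x i := by
      intro u _
      have := Finset.sum_add_sum_compl (B u) x
      have := hsmall u
      omega
    have h2 := Finset.sum_le_sum h1
    rw [Finset.sum_const, Finset.card_range, smul_eq_mul, Finset.sum_add_distrib] at h2
    have h3 : ∑ u ∈ Finset.range P, ∑ i ∈ B u, x i = ∑ i, m i * x i := by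
      have : ∀ u, ∑ i ∈ B u, x i = ∑ i, if i ∈ B u then x i else 0 := by
        intro u
        rw [← Finset.sum_filter]
        simp
      simp only [this]
      rw [Finset.sum_comm]
      refine Finset.sum_congr rfl fun i _ => ?_
      rw [← Finset.sum_filter, Finset.sum_const, smul_eq_mul]
    have h4 := Finset.sum_range_id_mul_two P
    have h5 : P * (P - 1) ≤ P * P := Nat.mul_le_mul_left _ (Nat.sub_le _ _)
    rw [h3] at h2
    rw [sq]
    omega
  -- Squares are written as sums of the weights `2u + 1`, so that only the cardinalities of `B u`
  -- and `A u` matter, although the sets may contain different jobs.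
  have hmm : ∑ i, m i ^ 2 ≤ ∑ i, natFlow I σ i ^ 2 := by
    have hswap : ∀ D : ℕ → Finset (Fin n),
        ∑ u ∈ Finset.range P, (D u).card * (2 * u + 1) =
          ∑ i, ∑ u ∈ Finset.range P with i ∈ D u, (2 * u + 1) := by
      intro D
      simp only [Finset.sum_filter]
      rw [Finset.sum_comm]
      refine Finset.sum_congr rfl fun u _ => ?_
      rw [← Finset.sum_filter, Finset.sum_const, smul_eq_mul]
      simp
    calc ∑ i, m i ^ 2 ≤ ∑ i, ∑ u ∈ Finset.range P with i ∈ B u, (2 * u + 1) :=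
          Finset.sum_le_sum fun i _ => card_sq_le_sum_odd _
      _ = ∑ u ∈ Finset.range P, (B u).card * (2 * u + 1) := (hswap B).symm
      _ ≤ ∑ u ∈ Finset.range P, (A u).card * (2 * u + 1) :=
          Finset.sum_le_sum fun u _ => Nat.mul_le_mul_right _ (hcard u)
      _ = ∑ i, ∑ u ∈ Finset.range P with i ∈ A u, (2 * u + 1) := hswap A
      _ ≤ ∑ i, natFlow I σ i ^ 2 := by
          refine Finset.sum_le_sum fun i _ => ?_
          rw [← sum_range_odd]
          refine Finset.sum_le_sum_of_subset fun u hu => ?_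
          have := hσ.completionTime_eq i
          simp only [hA, Finset.mem_filter, Finset.mem_univ, true_and] at hu
          simp only [Finset.mem_range]
          omega
  have hcount' : (∑ i, (x i : ℝ)) ^ 2 ≤ 2 * ∑ i, (m i : ℝ) * x i := by exact_mod_cast hcount
  have hmm' : ∑ i, (m i : ℝ) ^ 2 ≤ ∑ i, (natFlow I σ i : ℝ) ^ 2 := by exact_mod_cast hmm
  calc s * (∑ i, (x i : ℝ)) ^ 2 ≤ s * (2 * ∑ i, (m i : ℝ) * x i) := by gcongr
    _ = ∑ i, 2 * (s * x i) * m i := by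
        rw [Finset.mul_sum, Finset.mul_sum]
        exact Finset.sum_congr rfl fun i _ => by ring
    _ ≤ ∑ i, ((s * x i) ^ 2 + (m i : ℝ) ^ 2) :=
        Finset.sum_le_sum fun i _ => two_mul_le_add_sq _ _
    _ = s ^ 2 * ∑ i, (x i : ℝ) ^ 2 + ∑ i, (m i : ℝ) ^ 2 := by
        rw [Finset.sum_add_distrib, Finset.mul_sum]
        simp only [mul_pow]
    _ ≤ _ := by gcongr

end Tradeoff

/-! ### Waiting times of starving jobs and the length of a busy phase. -/

section Starving

variable {I : Instance n} {θ : ℝ} {ρ σ b : Schedule n}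

open Classical in
/-- The jobs that starve at some time. -/
noncomputable def starvingJobs (I : Instance n) (θ : ℝ) (b : Schedule n) : Finset (Fin n) :=
  Finset.univ.filter fun i => ∃ t, MeetsThreshold I θ b t i

/-- What remains of a job when it becomes starving. -/
noncomputable def starvingRemaining (I : Instance n) (θ : ℝ) (b : Schedule n) (i : Fin n) : ℕ :=
  remaining I b (starvingTime I θ b i) i

/-- The time that a job has waited when it becomes starving. -/
noncomputable def starvingWait (I : Instance n) (θ : ℝ) (b : Schedule n) (i : Fin n) : ℕ :=
  starvingTime I θ b i - I.release i

theorem mem_starvingJobs {i : Fin n} :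
    i ∈ starvingJobs I θ b ↔ ∃ t, MeetsThreshold I θ b t i := by
  simp [starvingJobs]

theorem active_starvingTime {i : Fin n} (h : i ∈ starvingJobs I θ b) :
    Active I b (starvingTime I θ b i) i :=
  (meetsThreshold_starvingTime (mem_starvingJobs.1 h)).1

theorem starvingTime_eq {i : Fin n} (h : i ∈ starvingJobs I θ b) :
    starvingTime I θ b i = I.release i + starvingWait I θ b i := by
  have := (active_starvingTime h).1
  unfold starvingWait
  omega

theorem mul_starvingRemaining_le {i : Fin n} (h : i ∈ starvingJobs I θ b) :
    θ * starvingRemaining I θ b i ≤ starvingWait I θ b i := by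
  have h1 := (meetsThreshold_starvingTime (mem_starvingJobs.1 h)).2
  have h2 : (0 : ℝ) < starvingRemaining I θ b i := by exact_mod_cast (active_starvingTime h).2
  have h3 : (starvingTime I θ b i : ℝ) = I.release i + starvingWait I θ b i := by
    exact_mod_cast starvingTime_eq h
  change θ ≤ (_ : ℝ) / (starvingRemaining I θ b i : ℝ) at h1
  rw [le_div_iff₀ h2] at h1
  linarith

/-- One slot earlier the threshold was missed with at most one more task left, so a positive wait
`w` satisfies `w - 1 < θ (q + 1)`; the bounds `θ, q ≥ 1` absorb the rest into `3 θ q`. -/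
theorem starvingWait_le {i : Fin n} (hb : OnlyActive I b) (hθ : 1 ≤ θ)
    (h : i ∈ starvingJobs I θ b) :
    (starvingWait I θ b i : ℝ) ≤ 3 * θ * starvingRemaining I θ b i := by
  have hq : 1 ≤ starvingRemaining I θ b i := (active_starvingTime h).2
  have hq' : (1 : ℝ) ≤ starvingRemaining I θ b i := by exact_mod_cast hq
  have hwe := starvingTime_eq h
  rcases Nat.eq_zero_or_pos (starvingWait I θ b i) with h0 | hpos
  · rw [h0, Nat.cast_zero]
    positivity
  set t := starvingTime I θ b i - 1 with ht
  have ht1 : starvingTime I θ b i = t + 1 := by omega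
  have hnot : ¬ MeetsThreshold I θ b t i :=
    Nat.notMem_of_lt_sInf (show t < starvingTime I θ b i by omega)
  have hrem := hb.remaining_succ t i
  have hrem' : remaining I b (t + 1) i = starvingRemaining I θ b i := by
    rw [starvingRemaining, ht1]
  rw [hrem'] at hrem
  have hact : Active I b t i := ⟨by omega, by omega⟩
  have hlt : waitRatio I b t i < θ := not_le.1 fun hle => hnot ⟨hact, hle⟩
  have hr0 : (0 : ℝ) < remaining I b t i := by exact_mod_cast hact.2
  rw [waitRatio, div_lt_iff₀ hr0] at hlt
  have hr1 : (remaining I b t i : ℝ) ≤ starvingRemaining I θ b i + 1 := by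
    have : remaining I b t i ≤ starvingRemaining I θ b i + 1 := by
      split_ifs at hrem <;> omega
    exact_mod_cast this
  have hcast : (t : ℝ) + 1 = I.release i + starvingWait I θ b i := by
    exact_mod_cast ht1.symm.trans hwe
  nlinarith

/-- The jobs' waiting times, weighted with what remains when they become starving, are paid for by
every schedule. -/
theorem IsBALSchedule.sum_mul_starvingWait_le (hb : IsBALSchedule I θ ρ b)
    (hρ : IsSRPTSchedule I ρ) (hσ : IsFeasible I σ) :
    ∑ i ∈ starvingJobs I θ b, starvingRemaining I θ b i * starvingWait I θ b i ≤
      ∑ i, natFlow I σ i ^ 2 := by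
  have hba := hb.onlyActive hρ.onlyActive
  set T := Finset.univ.sup (starvingTime I θ b)
  refine le_trans ?_ (hσ.sum_volume_le T)
  refine le_trans ?_ (Finset.sum_le_sum fun t _ =>
    hσ.onlyActive.sum_released_remaining_le hba
      ((hρ.sum_work_le hσ.onlyActive t).trans (hb.sum_work_le t)))
  simp only [Finset.sum_filter]
  rw [Finset.sum_comm]
  refine (Finset.sum_le_sum fun i _ => ?_).trans
    (Finset.sum_le_sum_of_subset (Finset.subset_univ (starvingJobs I θ b)))
  rw [← Finset.sum_filter]
  have hiT : starvingTime I θ b i ≤ T := Finset.le_sup (Finset.mem_univ i)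
  calc starvingRemaining I θ b i * starvingWait I θ b i
      = (Finset.Ico (I.release i) (starvingTime I θ b i)).card • starvingRemaining I θ b i := by
        rw [Nat.card_Ico, smul_eq_mul, mul_comm]
        rfl
    _ ≤ ∑ t ∈ Finset.Ico (I.release i) (starvingTime I θ b i), remaining I b t i :=
        Finset.card_nsmul_le_sum _ _ _ fun t ht =>
          remaining_anti I b i (Finset.mem_Ico.1 ht).2.le
    _ ≤ _ := by
        refine Finset.sum_le_sum_of_subset fun t ht => ?_
        simp only [Finset.mem_Ico] at ht
        simp only [Finset.mem_filter, Finset.mem_range]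
        omega

/-- Up to the time at which a job becomes starving, it is not ahead of the SRPT schedule, nor, from
time `a` on, of what the SRPT schedule has executed by time `a`, if `b` only catches up. -/
theorem IsBALSchedule.work_le_of_not_starving (hb : IsBALSchedule I θ ρ b) {a u : ℕ} {k : Fin n}
    (hcatch : ∀ t, a ≤ t → t < u → b t = some k → work b (t + 1) k ≤ work ρ a k)
    (hnot : ∀ t < u, b t = some k → k ∉ starvingSet I θ b t) : work b u k ≤ work ρ a k := by
  refine work_le_of_forall fun t ht hk => ?_
  rcases le_or_gt a t with hat | hta
  · exact hcatch t hat ht hk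
  -- Before `a`, a slot given to a job that is not starving executes a task that SRPT executes in
  -- some slot before `a`.
  · rcases hb.mem_or_pending hk with hmem | ⟨-, s, hs, -, hlt⟩
    · exact absurd hmem (hnot t ht hk)
    · have := work_mono ρ k (show s + 1 ≤ a by omega)
      simp only at this
      rw [work_succ_of_eq hk]
      omega

/-- While `b` is busy with jobs that starve or with what the SRPT schedule has done by time `a`,
it does not lag much behind. -/
theorem IsBALSchedule.sqrt_mul_sq_le (hb : IsBALSchedule I θ ρ b) (hρ : IsSRPTSchedule I ρ)
    (hσ : IsFeasible I σ) (hθ : 1 ≤ θ) {a c : ℕ} (hac : a ≤ c)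
    (hbusy : ∀ t, a ≤ t → t < c → ∃ k, b t = some k ∧
      ((k ∈ starvingSet I θ b t ∧ I.release k ≤ a) ∨
        (k ∉ starvingSet I θ b t ∧ work b (t + 1) k ≤ work ρ a k))) :
    √θ * ((c - a : ℕ) : ℝ) ^ 2 ≤ 2 * ∑ i, (natFlow I σ i : ℝ) ^ 2 := by
  have hba := hb.onlyActive hρ.onlyActive
  have hcatch : ∀ t k, a ≤ t → t < c → b t = some k → k ∉ starvingSet I θ b t →
      work b (t + 1) k ≤ work ρ a k := by
    intro t k hat htc hk hnot
    obtain ⟨k', hk', h⟩ := hbusy t hat htc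
    obtain rfl : k = k' := by simpa [hk] using hk'
    rcases h with h | h
    · exact absurd h.1 hnot
    · exact h.2
  -- The subtraction is truncated: `x k` is the lead of `b` at time `c` over SRPT at time `a`, and
  -- it is at most what SRPT has left of `k` at `a`.
  set x : Fin n → ℕ := fun k => work b c k - work ρ a k with hx
  have hlen : c - a ≤ ∑ k, x k := by
    have h1 := sum_work_add_of_busy (σ := b) hac fun t h1 h2 => by
      obtain ⟨k, hk, -⟩ := hbusy t h1 h2
      simp [hk]
    have h2 := hb.sum_work_le a
    have h3 : ∑ k, work b c k ≤ ∑ k, (x k + work ρ a k) :=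
      Finset.sum_le_sum fun k _ => by simp only [hx]; omega
    rw [Finset.sum_add_distrib] at h3
    omega
  have hrel : ∀ k, x k ≠ 0 → I.release k ≤ a := by
    intro k hk
    by_contra hlt
    refine hk (Nat.sub_eq_zero_of_le (work_le_of_forall fun t ht hkt => ?_))
    have h1 := (hba t k hkt).1
    refine hcatch t k (by omega) ht hkt fun hmem => ?_
    obtain ⟨k', hk', h⟩ := hbusy t (by omega) ht
    obtain rfl : k = k' := by simpa [hkt] using hk'
    rcases h with h | h
    · exact hlt h.2
    · exact h.1 hmem
  have hrem : ∀ k, x k ≤ remaining I ρ a k := by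
    intro k
    have := hba.work_le_size c k
    simp only [hx, remaining]
    omega
  -- A lead can only be built up after `k` becomes starving, when `starvingRemaining` tasks are
  -- left.
  have hstarv : ∀ k, x k ≠ 0 → k ∈ starvingJobs I θ b ∧ x k ≤ starvingRemaining I θ b k := by
    intro k hk
    have hmem : ∃ t < c, k ∈ starvingSet I θ b t := by
      by_contra hno
      refine hk (Nat.sub_eq_zero_of_le (hb.work_le_of_not_starving ?_ ?_))
      · exact fun t h1 h2 h3 => hcatch t k h1 h2 h3 fun h4 => hno ⟨t, h2, h4⟩
      · exact fun t h2 h3 h4 => hno ⟨t, h2, h4⟩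
    obtain ⟨t, htc, hkt⟩ := hmem
    have hj : k ∈ starvingJobs I θ b := mem_starvingJobs.2 (exists_meetsThreshold hkt)
    refine ⟨hj, ?_⟩
    have hle := starvingTime_le hkt
    have h1 : work b (starvingTime I θ b k) k ≤ work ρ a k := by
      refine hb.work_le_of_not_starving (fun u h1 h2 h3 => ?_) fun u h2 h3 h4 => ?_
      · exact hcatch u k h1 (by omega) h3 fun h4 => by
          have := starvingTime_le h4
          omega
      · have := starvingTime_le h4
        omega
    have h2 := hba.remaining_add_work (starvingTime I θ b k) k
    have h3 := hba.work_le_size c k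
    simp only [hx, starvingRemaining]
    omega
  have hsq : θ * ∑ k, (x k : ℝ) ^ 2 ≤ ∑ i, (natFlow I σ i : ℝ) ^ 2 := by
    have hsum : (∑ i ∈ starvingJobs I θ b,
        (starvingRemaining I θ b i : ℝ) * starvingWait I θ b i) ≤
        ∑ i, (natFlow I σ i : ℝ) ^ 2 := by
      exact_mod_cast hb.sum_mul_starvingWait_le hρ hσ
    refine le_trans ?_ hsum
    rw [Finset.mul_sum, ← Finset.sum_subset (Finset.subset_univ (starvingJobs I θ b))]
    · refine Finset.sum_le_sum fun k hk => ?_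
      have h1 := mul_starvingRemaining_le hk
      have h2 : (x k : ℝ) ≤ starvingRemaining I θ b k := by
        by_cases h0 : x k = 0
        · rw [h0, Nat.cast_zero]
          positivity
        · exact_mod_cast (hstarv k h0).2
      calc θ * (x k : ℝ) ^ 2 ≤ θ * (starvingRemaining I θ b k : ℝ) ^ 2 := by gcongr
        _ = starvingRemaining I θ b k * (θ * starvingRemaining I θ b k) := by ring
        _ ≤ _ := by gcongr
    · intro k _ hk
      have : x k = 0 := by
        by_contra h0
        exact hk (hstarv k h0).1
      simp [this]
  -- With `s = √θ` the term `s² ∑ x²` is `θ ∑ x²`, which `hsq` bounds.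
  have hmain := hρ.mul_sum_sq_le hσ hrel hrem (Real.sqrt_nonneg θ)
  rw [Real.sq_sqrt (by linarith)] at hmain
  have hlen' : ((c - a : ℕ) : ℝ) ≤ ∑ k, (x k : ℝ) := by exact_mod_cast hlen
  calc √θ * ((c - a : ℕ) : ℝ) ^ 2 ≤ √θ * (∑ k, (x k : ℝ)) ^ 2 := by gcongr
    _ ≤ _ := by linarith

end Starving

/-! ### Flow time of each job, and the sum over all jobs. -/

variable {I : Instance n} {θ : ℝ} {ρ σ b : Schedule n}

/-- The flow time of a job that never starves. -/
theorem natFlow_sq_le_of_normal (hb : IsBALSchedule I θ ρ b) (hρ : IsSRPTSchedule I ρ)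
    (hσ : IsFeasible I σ) (hθ : 1 ≤ θ) {i : Fin n} (hi : i ∉ starvingJobs I θ b) :
    (natFlow I b i : ℝ) ^ 2 ≤
      4 * θ * natFlow I ρ i + 4 * ((∑ j, (natFlow I σ j : ℝ) ^ 2) / √θ) := by
  have hbf := hb.isFeasible hρ.onlyActive
  have hρf := hρ.isFeasible hσ
  have hsqrt : 0 < √θ := Real.sqrt_pos.2 (by linarith)
  have hbc := hbf.completionTime_eq i
  have hρc := hρf.completionTime_eq i
  have hbs := hbf.size_le_natFlow i
  have hρs := hρf.size_le_natFlow i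
  have hpos := I.size_pos i
  set a := completionTime I ρ i with ha
  set c := completionTime I b i with hc
  obtain ⟨c', hc'⟩ : ∃ c', c = c' + 1 := ⟨c - 1, by omega⟩
  obtain ⟨a', ha'⟩ : ∃ a', a = a' + 1 := ⟨a - 1, by omega⟩
  have hshort : (c' : ℝ) - I.release i < θ := by
    have h1 : 0 < remaining I b c' i := remaining_pos_of_lt_completionTime (by omega)
    have h2 : remaining I b c' i ≤ 1 := by
      have h3 := hbf.onlyActive.remaining_succ c' i
      rw [hbf.remaining_eq_zero_iff.2 (by omega : completionTime I b i ≤ c' + 1)] at h3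
      split_ifs at h3 <;> omega
    have h3 : remaining I b c' i = 1 := by omega
    have hnot : ¬ MeetsThreshold I θ b c' i := fun h => hi (mem_starvingJobs.2 ⟨c', h⟩)
    have h4 : waitRatio I b c' i < θ := not_le.1 fun h => hnot ⟨⟨by omega, h1⟩, h⟩
    simpa [waitRatio, h3] using h4
  have hf : (natFlow I b i : ℝ) ≤ 2 * θ := by
    have : (c' : ℝ) + 1 = I.release i + natFlow I b i := by exact_mod_cast hc'.symm.trans hbc
    linarith
  have hO : 0 ≤ (∑ j, (natFlow I σ j : ℝ) ^ 2) / √θ := by positivity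
  rcases le_total c a with hca | hac
  · have hle : (natFlow I b i : ℝ) ≤ natFlow I ρ i := by
      have : natFlow I b i ≤ natFlow I ρ i := by omega
      exact_mod_cast this
    have h0 : (0 : ℝ) ≤ natFlow I b i := Nat.cast_nonneg _
    nlinarith
  have hlag := hb.sqrt_mul_sq_le hρ hσ hθ hac fun t hat htc => by
    by_cases hST : (starvingSet I θ b t).Nonempty
    · obtain ⟨k, hk, hbk, -⟩ := hb.starving t hST
      refine ⟨k, hbk, Or.inl ⟨hk, ?_⟩⟩
      have hkj : k ∈ starvingJobs I θ b := mem_starvingJobs.2 (exists_meetsThreshold hk)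
      -- Job `k` waited at least `θ` before starving, no later than `c'`, while `i` has waited less
      -- than `θ` at `c'`. Hence `k` was released before `i`.
      have h1 := mul_starvingRemaining_le hkj
      have h2 : (1 : ℝ) ≤ starvingRemaining I θ b k := by
        exact_mod_cast (active_starvingTime hkj).2
      have h3 : (I.release k : ℝ) + starvingWait I θ b k ≤ c' := by
        have h4 := starvingTime_le hk
        have h5 := starvingTime_eq hkj
        have : I.release k + starvingWait I θ b k ≤ c' := by omega
        exact_mod_cast this
      have h6 : (I.release i : ℝ) ≤ a := by
        have : I.release i ≤ a := by omega
        exact_mod_cast this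
      have h7 : (I.release k : ℝ) ≤ a := by nlinarith
      exact_mod_cast h7
    · have hρa : ρ a' = some i := by
        by_contra hne
        have h1 := hρ.onlyActive.remaining_succ a' i
        rw [if_neg hne, hρf.remaining_eq_zero_iff.2 (by omega : completionTime I ρ i ≤ a' + 1)] at h1
        have h2 : 0 < remaining I ρ a' i := remaining_pos_of_lt_completionTime (by omega)
        omega
      -- SRPT's last task of `i`, in slot `a'`, stays pending until `b` completes `i`, so `b`
      -- executes a task from slot `a'` or earlier.
      have hpend : Pending ρ b t a' := by
        refine ⟨i, hρa, ?_⟩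
        have h1 := hρ.onlyActive.remaining_add_work (a' + 1) i
        rw [hρf.remaining_eq_zero_iff.2 (by omega : completionTime I ρ i ≤ a' + 1)] at h1
        have h2 : 0 < remaining I b t i := remaining_pos_of_lt_completionTime htc
        have h3 := hbf.onlyActive.remaining_add_work t i
        omega
      obtain ⟨u, hu, ⟨k, hk, hlt⟩, hbu⟩ := hb.normal t hST a' (by omega) hpend
      refine ⟨k, hbu.trans hk, Or.inr ⟨fun h => hST ⟨k, h⟩, ?_⟩⟩
      rw [work_succ_of_eq (hbu.trans hk)]
      have := work_mono ρ k (show u + 1 ≤ a by omega)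
      simp only at this
      omega
  rw [mul_comm, ← le_div_iff₀ hsqrt, mul_div_assoc] at hlag
  have hsplit : (natFlow I b i : ℝ) = natFlow I ρ i + ((c - a : ℕ) : ℝ) := by
    have : natFlow I b i = natFlow I ρ i + (c - a) := by omega
    exact_mod_cast this
  have h0 : (0 : ℝ) ≤ natFlow I ρ i := Nat.cast_nonneg _
  have hd : (0 : ℝ) ≤ ((c - a : ℕ) : ℝ) := Nat.cast_nonneg _
  have hg : (natFlow I ρ i : ℝ) ^ 2 ≤ 2 * θ * natFlow I ρ i := by nlinarith
  have h2 := add_sq_le (a := (natFlow I ρ i : ℝ)) (b := ((c - a : ℕ) : ℝ))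
  rw [hsplit]
  linarith

/-- The flow time of a job that starves. -/
theorem natFlow_sq_le_of_starving (hb : IsBALSchedule I θ ρ b) (hρ : IsSRPTSchedule I ρ)
    (hσ : IsFeasible I σ) (hθ : 1 ≤ θ) {i : Fin n} (hi : i ∈ starvingJobs I θ b) :
    (natFlow I b i : ℝ) ^ 2 ≤ 6 * θ * (starvingRemaining I θ b i * starvingWait I θ b i : ℕ) +
      4 * ((∑ j, (natFlow I σ j : ℝ) ^ 2) / √θ) := by
  have hbf := hb.isFeasible hρ.onlyActive
  have hsqrt : 0 < √θ := Real.sqrt_pos.2 (by linarith)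
  have hbc := hbf.completionTime_eq i
  have hte := starvingTime_eq hi
  have hact := active_starvingTime hi
  set a := starvingTime I θ b i with ha
  set c := completionTime I b i with hc
  have hac : a < c := by
    by_contra hlt
    have := hbf.remaining_eq_zero_iff.2 (not_lt.1 hlt)
    have := hact.2
    omega
  -- From `a` on, job `i` is starving, so the executed job became starving no later than `a` and
  -- hence was released by then.
  have hlag := hb.sqrt_mul_sq_le hρ hσ hθ hac.le fun t hat htc => by
    have hit : i ∈ starvingSet I θ b t := mem_starvingSet.2
      ⟨⟨hact.1.trans hat, remaining_pos_of_lt_completionTime htc⟩, a, hat,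
        meetsThreshold_starvingTime (mem_starvingJobs.1 hi)⟩
    obtain ⟨k, hk, hbk, hmin⟩ := hb.starving t ⟨i, hit⟩
    refine ⟨k, hbk, Or.inl ⟨hk, ?_⟩⟩
    have h1 := (active_starvingTime (mem_starvingJobs.2 (exists_meetsThreshold hk))).1
    exact h1.trans (hmin i hit)
  rw [mul_comm, ← le_div_iff₀ hsqrt, mul_div_assoc] at hlag
  have hsplit : (natFlow I b i : ℝ) = starvingWait I θ b i + ((c - a : ℕ) : ℝ) := by
    have : natFlow I b i = starvingWait I θ b i + (c - a) := by omega
    exact_mod_cast this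
  have hw := starvingWait_le hbf.onlyActive hθ hi
  have hw' : (starvingWait I θ b i : ℝ) ^ 2 ≤
      3 * θ * (starvingRemaining I θ b i * starvingWait I θ b i) := by
    rw [sq, ← mul_assoc]
    gcongr
  have h2 := add_sq_le (a := (starvingWait I θ b i : ℝ)) (b := ((c - a : ℕ) : ℝ))
  rw [hsplit]
  push_cast
  linarith

/-- `BAL(θ)` against any feasible schedule. -/
theorem sum_natFlow_sq_le (hb : IsBALSchedule I θ ρ b) (hρ : IsSRPTSchedule I ρ)
    (hσ : IsFeasible I σ) (hθ : 1 ≤ θ) :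
    ∑ i, (natFlow I b i : ℝ) ^ 2 ≤ 10 * (θ + n / √θ) * ∑ i, (natFlow I σ i : ℝ) ^ 2 := by
  set O := ∑ j, (natFlow I σ j : ℝ) ^ 2 with hO
  set v : Fin n → ℝ := fun i => (starvingRemaining I θ b i * starvingWait I θ b i : ℕ) with hv
  have hO0 : 0 ≤ O := by positivity
  have hjob : ∀ i, (natFlow I b i : ℝ) ^ 2 ≤ 4 * θ * natFlow I ρ i +
      6 * θ * (if i ∈ starvingJobs I θ b then v i else 0) + 4 * (O / √θ) := by
    intro i
    split_ifs with hi
    · have h1 := natFlow_sq_le_of_starving hb hρ hσ hθ hi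
      have h2 : 0 ≤ 4 * θ * natFlow I ρ i := by positivity
      simp only [hv]
      linarith
    · have h1 := natFlow_sq_le_of_normal hb hρ hσ hθ hi
      linarith
  have h1 : ∑ i, (natFlow I ρ i : ℝ) ≤ O := by
    have h2 : ∑ i, natFlow I ρ i ≤ ∑ i, natFlow I σ i ^ 2 :=
      (hρ.sum_natFlow_le hσ).trans (Finset.sum_le_sum fun i _ => Nat.le_self_pow two_ne_zero _)
    rw [hO]
    exact_mod_cast h2
  have h2 : ∑ i, (if i ∈ starvingJobs I θ b then v i else 0) ≤ O := by
    rw [← Finset.sum_filter, Finset.filter_univ_mem, hO]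
    simp only [hv]
    exact_mod_cast hb.sum_mul_starvingWait_le hρ hσ
  calc ∑ i, (natFlow I b i : ℝ) ^ 2
      ≤ ∑ i, (4 * θ * natFlow I ρ i +
          6 * θ * (if i ∈ starvingJobs I θ b then v i else 0) + 4 * (O / √θ)) :=
        Finset.sum_le_sum fun i _ => hjob i
    _ = 4 * θ * ∑ i, (natFlow I ρ i : ℝ) +
          6 * θ * ∑ i, (if i ∈ starvingJobs I θ b then v i else 0) + n * (4 * (O / √θ)) := by
        rw [Finset.sum_add_distrib, Finset.sum_add_distrib, ← Finset.mul_sum, ← Finset.mul_sum]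
        simp
    _ ≤ 4 * θ * O + 6 * θ * O + n * (4 * (O / √θ)) := by gcongr
    _ ≤ 4 * θ * O + 6 * θ * O + n * (10 * (O / √θ)) := by gcongr; norm_num
    _ = 10 * (θ + n / √θ) * O := by ring

/-! ### The norm and the choice of threshold. -/

theorem IsFeasible.l2FlowTime_eq (h : IsFeasible I σ) :
    l2FlowTime I σ = √(∑ i, (natFlow I σ i : ℝ) ^ 2) := by
  simp only [l2FlowTime, h.flowTime_eq]

/-- The ratio of `BAL(θ)` for a threshold that is a power of an estimate of the number of jobs. -/
theorem threshold_add_div_sqrt_le {N α β e : ℝ} (hN : 0 < N) (hβ : 0 < β) (hα : 0 ≤ α)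
    (he : β * N ≤ e) (he' : e ≤ α * N) :
    e ^ (2 / 3 : ℝ) + N / √(e ^ (2 / 3 : ℝ)) ≤
      (N ^ (1 / 3 : ℝ) * (β ^ (-1 / 6 : ℝ) + α ^ (1 / 3 : ℝ))) ^ 2 := by
  have hβN : 0 < β * N := mul_pos hβ hN
  have he0 : 0 < e := hβN.trans_le he
  have h1 : e ^ (2 / 3 : ℝ) ≤ (N ^ (1 / 3 : ℝ) * α ^ (1 / 3 : ℝ)) ^ 2 := by
    calc e ^ (2 / 3 : ℝ) ≤ (α * N) ^ (2 / 3 : ℝ) := by gcongr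
      _ = (N ^ (1 / 3 : ℝ) * α ^ (1 / 3 : ℝ)) ^ 2 := by
        rw [← Real.mul_rpow hN.le hα, ← Real.rpow_natCast, ← Real.rpow_mul (by positivity),
          mul_comm α]
        norm_num
  have h2 : N / √(e ^ (2 / 3 : ℝ)) ≤ (N ^ (1 / 3 : ℝ) * β ^ (-1 / 6 : ℝ)) ^ 2 := by
    have hs : √(e ^ (2 / 3 : ℝ)) = e ^ (1 / 3 : ℝ) := by
      rw [Real.sqrt_eq_rpow, ← Real.rpow_mul he0.le]
      norm_num
    calc N / √(e ^ (2 / 3 : ℝ)) ≤ N / (β * N) ^ (1 / 3 : ℝ) := by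
          rw [hs]
          gcongr
      _ = (N ^ (1 / 3 : ℝ) * β ^ (-1 / 6 : ℝ)) ^ 2 := by
          rw [mul_pow, ← Real.rpow_natCast, ← Real.rpow_natCast, ← Real.rpow_mul hN.le,
            ← Real.rpow_mul hβ.le, Real.mul_rpow hβ.le hN.le, div_eq_iff (by positivity)]
          calc N = N ^ ((1 / 3 : ℝ) * (2 : ℕ) + 1 / 3) * β ^ ((-1 / 6 : ℝ) * (2 : ℕ) + 1 / 3) := by
                norm_num
            _ = _ := by
                rw [Real.rpow_add hN, Real.rpow_add hβ]
                ring
  have h3 : 0 ≤ N ^ (1 / 3 : ℝ) * α ^ (1 / 3 : ℝ) := by positivity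
  have h4 : 0 ≤ N ^ (1 / 3 : ℝ) * β ^ (-1 / 6 : ℝ) := by positivity
  nlinarith

end FlowTime

theorem mainTheorem1 :
    ∃ C : ℝ, 0 < C ∧
      ∀ (n : ℕ) (α β nEst : ℝ), 1 ≤ n → 1 / (n : ℝ) ≤ β → β ≤ 1 → 1 ≤ α →
        β * (n : ℝ) ≤ nEst → nEst ≤ α * (n : ℝ) →
        ∀ srpt : FlowTime.OnlineAlgorithm n, srpt.IsSRPT →
          (FlowTime.BAL srpt (nEst ^ (2 / 3 : ℝ))).IsCompetitive
            (C * ((n : ℝ) ^ (1 / 3 : ℝ) * (β ^ (-1 / 6 : ℝ) + α ^ (1 / 3 : ℝ)))) := by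
  -- Any constant with square at least `10` works.
  refine ⟨4, by norm_num, fun n α β e hn hβ _ hα he he' srpt hsrpt I => ?_⟩
  have hN : (0 : ℝ) < n := by exact_mod_cast hn
  have hβ0 : 0 < β := (by positivity : (0 : ℝ) < 1 / n).trans_le hβ
  -- The bound `β ≥ 1/n` serves to make the estimate, and hence the threshold, at least `1`.
  have he1 : 1 ≤ e := ((div_le_iff₀ hN).1 hβ).trans he
  have hθ : 1 ≤ e ^ (2 / 3 : ℝ) := Real.one_le_rpow he1 (by norm_num)
  have hρ := hsrpt I
  have hb := FlowTime.isBALSchedule I (e ^ (2 / 3 : ℝ)) (srpt.schedule I)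
  have hbf := hb.isFeasible hρ.onlyActive
  refine ⟨hbf, fun σ hσ => ?_⟩
  change FlowTime.l2FlowTime I (FlowTime.balSchedule I (e ^ (2 / 3 : ℝ)) (srpt.schedule I)) ≤ _
  rw [hbf.l2FlowTime_eq, hσ.l2FlowTime_eq]
  have hratio := FlowTime.threshold_add_div_sqrt_le hN hβ0 (by linarith) he he'
  set K := (n : ℝ) ^ (1 / 3 : ℝ) * (β ^ (-1 / 6 : ℝ) + α ^ (1 / 3 : ℝ)) with hK
  have hK0 : 0 ≤ K := by positivity
  refine Real.sqrt_le_iff.2 ⟨by positivity, ?_⟩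
  rw [mul_pow, Real.sq_sqrt (by positivity)]
  refine (FlowTime.sum_natFlow_sq_le hb hρ hσ hθ).trans ?_
  gcongr
  nlinarith [sq_nonneg K]
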